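/- Let $S^1=\mathbb R/\mathbb Z$, and let $\pi:\mathbb R^2\to S^1\times\mathbb R$, $\pi(\phi,I)=(\phi \bmod 1, I)$. Let $T=(T_\phi,T_I):\mathbb R^2\to\mathbb R^2$ be a $C^1$ diffeomorphism of the plane that is a lift of a $C^1$ diffeomorphism $\widehat T$ of the cylinder $S^1\times\mathbb R$ (that is, $\pi\circ T=\widehat T\circ\pi$), such that $\partial_I T_\phi>0$ everywhere, for every $\phi$ both $T_\phi(\phi,I)\to\pm\infty$ and $T_I(\phi,I)\to\pm\infty$ as $I\to\pm\infty$, and $$T_I(\phi+1,I)=T_I(\phi,I),\quad T_I(\phi,I+1)=T_I(\phi,I)+1,\quad T_\phi(\phi+1,I)=T_\phi(\phi,I)+1,\quad T_\phi(\phi,I+1)=T_\phi(\phi,I)+1$$ for all $(\phi,I)\in\mathbb R^2$ (the class of such $T$ is called $TQ$). Suppose that $\widehat T$ is $\mu$-exact for some Borel measure $\mu$ on the cylinder that is finite on compact sets, positive on nonempty open sets and absolutely continuous with respect to Lebesgue measure; this means that $\widehat T$ preserves $\mu$ and that $\mu(\widehat T(A)\setminus A)=\mu(A\setminus\widehat T(A))$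 for every open set $A\subset S^1\times\mathbb R$ that is homeomorphic to the cylinder and has compact boundary. Suppose also that $T$ has no rotational invariant circle (R.I.C.), i.e. there is no homotopically non-trivial simple closed curve $C\subset S^1\times\mathbb R$ with $\widehat T(C)=C$. Then for every integer $k\ge 1$ there are an integer $N>0$, a point $P=(\phi_P,I_P)\in[0,1]^2$ and an integer $s$ such that $$T^N(\phi_P,I_P)=(\phi_P+s,\,I_P^N)\quad\text{with}\quad I_P^N>I_P+k .$$ -/

import Mathlib

open MeasureTheory Filter

namespace TwistMap

/-- The cylinder `S¹ × ℝ = (ℝ/ℤ) × ℝ`, with coordinates `(φ, I)`. -/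
abbrev Cylinder : Type := UnitAddCircle × ℝ

/-- The universal covering `π : ℝ² → S¹ × ℝ`, `π (φ, I) = (φ mod 1, I)`. -/
def proj (z : ℝ × ℝ) : Cylinder := ((z.1 : UnitAddCircle), z.2)

/-- The plane map `f` is a lift of the cylinder map `F`. Since `proj` is onto, `F` is determined
by `f`: it is the map induced by `f`. -/
def IsLift (f : ℝ × ℝ → ℝ × ℝ) (F : Cylinder → Cylinder) : Prop :=
  ∀ z, F (proj z) = proj (f z)

/-- `f` is a `C¹` diffeomorphism of the plane onto itself. -/
def IsC1DiffeoPlane (f : ℝ × ℝ → ℝ × ℝ) : Prop :=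
  ContDiff ℝ 1 f ∧
    ∃ g : ℝ × ℝ → ℝ × ℝ, ContDiff ℝ 1 g ∧ Function.LeftInverse g f ∧ Function.RightInverse g f

/-- `F` is a `C¹` map of the cylinder: read through the local diffeomorphism `proj`, it is given
near every point by a `C¹` map of the plane. -/
def IsC1Cylinder (F : Cylinder → Cylinder) : Prop :=
  ∀ z : ℝ × ℝ, ∃ g : ℝ × ℝ → ℝ × ℝ, ContDiffAt ℝ 1 g z ∧
    ∀ᶠ w in nhds z, F (proj w) = proj (g w)

/-- `F` is a `C¹` diffeomorphism of the cylinder onto itself. -/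
def IsC1DiffeoCylinder (F : Cylinder → Cylinder) : Prop :=
  IsC1Cylinder F ∧
    ∃ G : Cylinder → Cylinder,
      IsC1Cylinder G ∧ Function.LeftInverse G F ∧ Function.RightInverse G F

/-- The set `D_r^1(ℝ²)` of lifts of right twist `C¹` diffeomorphisms of the cylinder. -/
structure IsTwistLift (f : ℝ × ℝ → ℝ × ℝ) : Prop where
  diffeo : IsC1DiffeoPlane f
  vert_top : ∀ φ : ℝ, Tendsto (fun I : ℝ => (f (φ, I)).2) atTop atTop
  vert_bot : ∀ φ : ℝ, Tendsto (fun I : ℝ => (f (φ, I)).2) atBot atBot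
  twist : ∀ φ I : ℝ, 0 < deriv (fun t : ℝ => (f (φ, t)).1) I
  horiz_top : ∀ φ : ℝ, Tendsto (fun I : ℝ => (f (φ, I)).1) atTop atTop
  horiz_bot : ∀ φ : ℝ, Tendsto (fun I : ℝ => (f (φ, I)).1) atBot atBot
  lift : ∃ F : Cylinder → Cylinder, IsC1DiffeoCylinder F ∧ IsLift f F

/-- The set `TQ` of lifts of twist maps of the torus: elements `T = (T_φ, T_I)` of `D_r^1(ℝ²)`
satisfying the four periodicity relations. -/
def TQ : Set (ℝ × ℝ → ℝ × ℝ) :=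
  {T | IsTwistLift T ∧
    (∀ φ I : ℝ, (T (φ + 1, I)).2 = (T (φ, I)).2) ∧
    (∀ φ I : ℝ, (T (φ, I + 1)).2 = (T (φ, I)).2 + 1) ∧
    (∀ φ I : ℝ, (T (φ + 1, I)).1 = (T (φ, I)).1 + 1) ∧
    (∀ φ I : ℝ, (T (φ, I + 1)).1 = (T (φ, I)).1 + 1)}

/-- `F` is `μ`-exact. The measure `μ` on the cylinder is finite on compact sets, positive on
nonempty open sets and absolutely continuous with respect to Lebesgue measure; `F` preserves `μ`,
and the net `μ`-flux through `A` vanishes for all open sets `A` homeomorphic to the cylinder.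
Only sets `A` with compact frontier are tested (such as the region below an essential simple
closed curve): for a set `A` whose frontier reaches an end of the cylinder the equality may fail
although `F` is an exact area-preserving map. -/
structure IsExact (μ : Measure Cylinder) (F : Cylinder → Cylinder) : Prop where
  finite_compact : ∀ K : Set Cylinder, IsCompact K → μ K < ⊤
  pos_open : ∀ U : Set Cylinder, IsOpen U → U.Nonempty → 0 < μ U
  abs_cont : μ ≪ (volume : Measure Cylinder)
  invariant : MeasurePreserving F μ μ
  flux : ∀ A : Set Cylinder, IsOpen A → Nonempty (A ≃ₜ Cylinder) → IsCompact (frontier A) →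
    μ (F '' A \ A) = μ (A \ F '' A)

/-- `C` is a rotational invariant circle of the cylinder map `F`: a simple closed curve on the
cylinder that is not homotopic to a point, with `F(C) = C`. -/
def IsRIC (F : Cylinder → Cylinder) (C : Set Cylinder) : Prop :=
  (∃ γ : C(UnitAddCircle, Cylinder),
    Function.Injective γ ∧ ¬ γ.Nullhomotopic ∧ Set.range γ = C) ∧ F '' C = C

end TwistMap

namespace TwistMap

open Set Topology

/-! Everything turns on whether the iterates of the lower half plane climb without bound. If they
do, follow the image of a vertical ray ending at a very high point, between a moderate height and
the top. Either this arc already spreads over a horizontal unit, or its ends differ so much in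
height that one more twist spreads it. In both cases it meets a translate of the starting vertical
by an integer, high up (`exists_return_of_unbounded`). If they stay bounded, fill in everything
vertically below them. Such envelopes never jump up from left to right, so the filled region is
mapped into itself (`image_hull_subset`). Zero flux makes the inclusion an equality up to a null set
(`measure_diff_image_eq_zero`), and taking the interior of the closure makes it exact. Birkhoff's
argument (`exists_continuous_eq_below`) then shows that the region lies below a continuous periodic
graph, which is an invariant circle (`exists_isRIC_of_bounded`). -/

/-- A homeomorphism of the plane that twists verticals to the right and commutes with integer
translations in the way the lifts of twist maps of the torus do. -/
structure IsTwistHomeo (e : (ℝ × ℝ) ≃ₜ (ℝ × ℝ)) : Prop where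
  mono : ∀ φ, StrictMono fun I : ℝ => (e (φ, I)).1
  add_fst : ∀ z, e (z + (1, 0)) = e z + (1, 0)
  add_snd : ∀ z, e (z + (0, 1)) = e z + (1, 1)

/-! ### Hulls and upper envelopes of planar sets -/

/-- The points lying on or below a point of `A` on the same vertical. -/
def hull (A : Set (ℝ × ℝ)) : Set (ℝ × ℝ) := {z | ∃ w ∈ A, w.1 = z.1 ∧ z.2 ≤ w.2}

/-- The upper envelope of `A` does not jump up when read from left to right. -/
def NoUpJump (A : Set (ℝ × ℝ)) : Prop :=
  ∀ w ∈ A, ∀ h < w.2, ∀ᶠ x in 𝓝[<] w.1, (x, h) ∈ hull A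

theorem hull_mono_snd {A : Set (ℝ × ℝ)} {x i j : ℝ} (h : (x, j) ∈ hull A) (hij : i ≤ j) :
    (x, i) ∈ hull A := by
  obtain ⟨w, hw, h1, h2⟩ := h
  exact ⟨w, hw, h1, hij.trans h2⟩

theorem subset_hull (A : Set (ℝ × ℝ)) : A ⊆ hull A := fun z hz => ⟨z, hz, rfl, le_rfl⟩

/-- The bound `M` keeps the points of `A` above a convergent sequence from escaping upwards, so a
subsequence of them converges. -/
theorem isClosed_hull {A : Set (ℝ × ℝ)} (hA : IsClosed A) {M : ℝ} (hM : ∀ z ∈ A, z.2 ≤ M) :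
    IsClosed (hull A) := by
  refine IsSeqClosed.isClosed fun u z hu huz => ?_
  choose w hwA hw1 hw2 using hu
  have hu2 : Tendsto (fun n => (u n).2) atTop (𝓝 z.2) := (continuous_snd.tendsto z).comp huz
  have hu1 : Tendsto (fun n => (u n).1) atTop (𝓝 z.1) := (continuous_fst.tendsto z).comp huz
  obtain ⟨c, hc⟩ := hu2.bddBelow_range
  obtain ⟨a, -, θ, hθ, ha⟩ := isCompact_Icc.tendsto_subseq (x := fun n => (w n).2)
    (s := Icc c M) fun n => ⟨(hc (mem_range_self n)).trans (hw2 n), hM _ (hwA n)⟩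
  have hlim : Tendsto (w ∘ θ) atTop (𝓝 (z.1, a)) := by
    have h1 : Tendsto (fun n => (w (θ n)).1) atTop (𝓝 z.1) := by
      simp only [hw1]; exact hu1.comp hθ.tendsto_atTop
    exact h1.prodMk_nhds ha
  exact ⟨(z.1, a), hA.mem_of_tendsto hlim (Eventually.of_forall fun n => hwA _), rfl,
    le_of_tendsto_of_tendsto' (hu2.comp hθ.tendsto_atTop) ha fun n => hw2 _⟩

/-! ### Real functions, periodicity and integer translations -/

theorem eventually_nhdsGT_exists_eq {f : ℝ → ℝ} (hf : Continuous f) (hm : StrictMono f) {a : ℝ}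
    {P : ℝ → Prop} (hP : ∀ᶠ y in 𝓝[>] a, P y) :
    ∀ᶠ x in 𝓝[>] f a, ∃ y, a < y ∧ f y = x ∧ P y := by
  obtain ⟨b, hab, hb⟩ := mem_nhdsGT_iff_exists_Ioo_subset.1 hP
  filter_upwards [Ioo_mem_nhdsGT (hm hab)] with x hx
  obtain ⟨y, hy, rfl⟩ := intermediate_value_Ioo (le_of_lt hab) hf.continuousOn hx
  exact ⟨y, hy.1, rfl, hb hy⟩

theorem eventually_nhdsLT_exists_eq {f : ℝ → ℝ} (hf : Continuous f) (hm : StrictMono f) {a : ℝ}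
    {P : ℝ → Prop} (hP : ∀ᶠ y in 𝓝[<] a, P y) :
    ∀ᶠ x in 𝓝[<] f a, ∃ y, y < a ∧ f y = x ∧ P y := by
  obtain ⟨b, hab, hb⟩ := mem_nhdsLT_iff_exists_Ioo_subset.1 hP
  filter_upwards [Ioo_mem_nhdsLT (hm hab)] with x hx
  obtain ⟨y, hy, rfl⟩ := intermediate_value_Ioo (le_of_lt hab) hf.continuousOn hx
  exact ⟨y, hy.2, rfl, hb hy⟩

theorem eventually_nhdsLT_exists_eq_of_anti {f : ℝ → ℝ} (hf : Continuous f) (hm : StrictAnti f)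
    {a : ℝ} {P : ℝ → Prop} (hP : ∀ᶠ y in 𝓝[>] a, P y) :
    ∀ᶠ x in 𝓝[<] f a, ∃ y, a < y ∧ f y = x ∧ P y := by
  obtain ⟨b, hab, hb⟩ := mem_nhdsGT_iff_exists_Ioo_subset.1 hP
  filter_upwards [Ioo_mem_nhdsLT (hm hab)] with x hx
  obtain ⟨y, hy, rfl⟩ := intermediate_value_Ioo' (le_of_lt hab) hf.continuousOn hx
  exact ⟨y, hy.1, rfl, hb hy⟩

/-- A continuous real function moving by at least `1` takes a value in `c + ℤ`. -/
theorem exists_eq_add_int {f : ℝ → ℝ} (hf : Continuous f) {a b : ℝ} (hab : a ≤ b)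
    (h : 1 ≤ |f b - f a|) (c : ℝ) : ∃ t ∈ Icc a b, ∃ s : ℤ, f t = c + s := by
  have key : ∀ p q : ℝ, 1 ≤ q - p → ∃ s : ℤ, c + s ∈ Icc p q := fun p q hpq =>
    ⟨⌈p - c⌉, by linarith [Int.le_ceil (p - c)], by linarith [Int.ceil_lt_add_one (p - c)]⟩
  rcases le_abs'.1 h with h | h
  · obtain ⟨s, hs⟩ := key (f b) (f a) (by linarith)
    obtain ⟨t, ht, hts⟩ := intermediate_value_Icc' hab hf.continuousOn hs
    exact ⟨t, ht, s, hts⟩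
  · obtain ⟨s, hs⟩ := key (f a) (f b) (by linarith)
    obtain ⟨t, ht, hts⟩ := intermediate_value_Icc hab hf.continuousOn hs
    exact ⟨t, ht, s, hts⟩

/-- A continuous function on the plane with period `1` in both variables is bounded. -/
theorem exists_abs_le_of_periodic {f : ℝ × ℝ → ℝ} (hf : Continuous f)
    (h1 : ∀ z, f (z + (1, 0)) = f z) (h2 : ∀ z, f (z + (0, 1)) = f z) :
    ∃ C, ∀ z, |f z| ≤ C := by
  have hp1 : ∀ y, Function.Periodic (fun x => f (x, y)) 1 := fun y x => by
    simpa using h1 (x, y)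
  have hp2 : ∀ x, Function.Periodic (fun y => f (x, y)) 1 := fun x y => by
    simpa using h2 (x, y)
  obtain ⟨C, hC⟩ := (isCompact_Icc (a := (0 : ℝ)) (b := 1)).prod
    (isCompact_Icc (a := (0 : ℝ)) (b := 1)) |>.exists_bound_of_continuousOn hf.continuousOn
  refine ⟨C, fun z => ?_⟩
  have e1 : f z = f (Int.fract z.1, Int.fract z.2) := by
    have a := (hp1 z.2).sub_int_mul_eq (x := z.1) ⌊z.1⌋
    have b := (hp2 (Int.fract z.1)).sub_int_mul_eq (x := z.2) ⌊z.2⌋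
    simp only [mul_one] at a b
    simp only [Int.fract] at b ⊢
    rw [b, a]
  rw [e1]
  exact hC _ ⟨⟨Int.fract_nonneg _, (Int.fract_lt_one _).le⟩,
    ⟨Int.fract_nonneg _, (Int.fract_lt_one _).le⟩⟩

theorem map_add_zsmul {G H : Type*} [AddCommGroup G] [AddCommGroup H] {f : G → H} {v : G} {w : H}
    (h : ∀ z, f (z + v) = f z + w) (m : ℤ) (z : G) : f (z + m • v) = f z + m • w := by
  induction m using Int.induction_on generalizing z with
  | zero => simp
  | succ i ih => rw [add_zsmul, one_zsmul, ← add_assoc, h, ih, add_zsmul, one_zsmul, add_assoc]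
  | pred i ih =>
    have := h (z + (-(i : ℤ) - 1) • v)
    rw [add_assoc, sub_smul, one_zsmul, sub_add_cancel, ih] at this
    rw [sub_smul, one_zsmul, sub_smul, one_zsmul, ← add_sub_assoc (f z), this, add_sub_cancel_right]

/-! ### Twist homeomorphisms and their inverses -/

namespace IsTwistHomeo

variable {e : (ℝ × ℝ) ≃ₜ (ℝ × ℝ)}

theorem symm_add_snd (he : IsTwistHomeo e) (z : ℝ × ℝ) :
    e.symm (z + (0, 1)) = e.symm z + (-1, 1) := by
  rw [Homeomorph.symm_apply_eq]
  have h := he.add_fst (e.symm z + (-1, 1))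
  have h' : e.symm z + (-1, 1) + (1, 0) = e.symm z + (0, 1) := by
    rw [add_assoc]; simp
  rw [h', he.add_snd, e.apply_symm_apply] at h
  have h3 : z + ((1 : ℝ), (1 : ℝ)) = z + (0, 1) + (1, 0) := by
    rw [add_assoc]; simp
  exact add_right_cancel (h3 ▸ h)

/-- The inverse of a twist homeomorphism tilts verticals to the left. -/
theorem symm_anti (he : IsTwistHomeo e) (φ : ℝ) : StrictAnti fun I : ℝ => (e.symm (φ, I)).1 := by
  have hc : Continuous fun I : ℝ => (e.symm (φ, I)).1 := by fun_prop
  have hinj : Function.Injective fun I : ℝ => (e.symm (φ, I)).1 := by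
    intro a b hab
    have ha : e ((e.symm (φ, a)).1, (e.symm (φ, a)).2) = (φ, a) := e.apply_symm_apply _
    have hb : e ((e.symm (φ, a)).1, (e.symm (φ, b)).2) = (φ, b) := by
      have hab' : (e.symm (φ, a)).1 = (e.symm (φ, b)).1 := hab
      rw [hab']; exact e.apply_symm_apply _
    have := (he.mono (e.symm (φ, a)).1).injective
      (a₁ := (e.symm (φ, a)).2) (a₂ := (e.symm (φ, b)).2) (by simp only [ha, hb])
    rw [this, hb] at ha
    exact (congrArg Prod.snd ha).symm
  -- A continuous injection of the line is strictly monotone; raising the height by 1 moves the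
  -- preimage left by 1, so it cannot increase.
  refine (hc.strictMono_of_inj hinj).resolve_left fun hm => ?_
  have h1 := hm (zero_lt_one' ℝ)
  have h2 := he.symm_add_snd (φ, 0)
  simp only [Prod.mk_add_mk, add_zero, zero_add] at h2
  simp only [h2, Prod.fst_add] at h1
  linarith

theorem apply_add_int (he : IsTwistHomeo e) (z : ℝ × ℝ) (m n : ℤ) :
    e (z + ((m : ℝ), (n : ℝ))) = e z + ((m : ℝ) + n, (n : ℝ)) := by
  have h1 := map_add_zsmul he.add_fst m z
  have h2 := map_add_zsmul he.add_snd n (z + m • ((1 : ℝ), (0 : ℝ)))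
  have hz : z + ((m : ℝ), (n : ℝ)) = z + m • ((1 : ℝ), (0 : ℝ)) + n • ((0 : ℝ), (1 : ℝ)) := by
    ext <;> simp
  rw [hz, h2, h1]
  ext <;> simp [add_assoc]

theorem iterate_add_int (he : IsTwistHomeo e) (N : ℕ) (z : ℝ × ℝ) (m n : ℤ) :
    e^[N] (z + ((m : ℝ), (n : ℝ))) = e^[N] z + ((m : ℝ) + N * n, (n : ℝ)) := by
  induction N generalizing z m with
  | zero => simp
  | succ N ih =>
    have h : e (z + ((m : ℝ), (n : ℝ))) = e z + (((m + n : ℤ) : ℝ), (n : ℝ)) := by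
      rw [he.apply_add_int]; push_cast; rfl
    rw [Function.iterate_succ_apply, Function.iterate_succ_apply, h, ih]
    congr 2; push_cast; ring

/-- Both differences are periodic in each variable: up to a bounded error the map is the linear
shear (φ, I) ↦ (φ + I, I). -/
theorem exists_bound (he : IsTwistHomeo e) : ∃ C : ℝ, 0 ≤ C ∧ (∀ z, |(e z).2 - z.2| ≤ C) ∧
    ∀ z, |(e z).1 - z.1 - z.2| ≤ C := by
  obtain ⟨C, hC⟩ := exists_abs_le_of_periodic (f := fun z => (e z).2 - z.2) (by fun_prop)
    (fun z => by simp [he.add_fst]) (fun z => by simp [he.add_snd])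
  obtain ⟨D, hD⟩ := exists_abs_le_of_periodic (f := fun z => (e z).1 - z.1 - z.2) (by fun_prop)
    (fun z => by simp [he.add_fst]) (fun z => by simp [he.add_snd]; ring)
  exact ⟨max C D, ((abs_nonneg _).trans (hC 0)).trans (le_max_left _ _),
    fun z => (hC z).trans (le_max_left _ _), fun z => (hD z).trans (le_max_right _ _)⟩

/-! ### Envelopes under a twist map -/

/-- If the envelope of `A` has no upward jump, the points above which `A` lies are mapped to
points above which the image of `A` lies. -/
theorem image_hull_subset (he : IsTwistHomeo e) {A : Set (ℝ × ℝ)} (hA : IsClosed A) {M : ℝ}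
    (hM : ∀ z ∈ A, z.2 ≤ M) (hJ : NoUpJump A) : e '' hull A ⊆ hull (e '' A) := by
  rintro _ ⟨z, hz, rfl⟩
  obtain ⟨C, -, hC, -⟩ := he.exists_bound
  set ψ := (e z).1
  set c : ℝ → ℝ × ℝ := fun y => e.symm (ψ, y)
  have hcc : Continuous c := by fun_prop
  have hec : ∀ y, e (c y) = (ψ, y) := fun y => e.apply_symm_apply _
  have hc0 : c (e z).2 = z := e.symm_apply_apply z
  -- Climb the vertical above `e z`, watching its preimage `c`, which drifts left, and stop at the
  -- last height where `c` is in the hull. There `c` must touch `A`.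
  set Y : Set ℝ := {y | (e z).2 ≤ y ∧ c y ∈ hull A}
  have hYc : IsClosed Y := isClosed_Ici.inter ((isClosed_hull hA hM).preimage hcc)
  have hYn : Y.Nonempty := ⟨(e z).2, le_rfl, by rwa [hc0]⟩
  have hYb : BddAbove Y := by
    refine ⟨M + C, fun y hy => ?_⟩
    obtain ⟨w, hw, -, hle⟩ := hy.2
    have h1 := abs_le.1 (hC (c y))
    rw [hec] at h1
    have := hM w hw
    have := h1.2
    dsimp only at this
    linarith
  set s := sSup Y
  have hs : s ∈ Y := hYc.csSup_mem hYn hYb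
  obtain ⟨w, hw, hw1, hw2⟩ := hs.2
  rcases hw2.eq_or_lt with heq | hlt
  · have : w = c s := Prod.ext hw1 heq.symm
    exact ⟨e w, mem_image_of_mem _ hw, by rw [this, hec], by rw [this, hec]; exact hs.1⟩
  · exfalso
    -- If `c s` were strictly below `w`, the envelope just to the left would still exceed `h`, so
    -- `c` would remain in the hull a little longer.
    obtain ⟨h, hh1, hh2⟩ := exists_between hlt
    have ev := hJ w hw h hh2
    have ht : Tendsto (fun y => (c y).1) (𝓝[>] s) (𝓝[<] w.1) := by
      rw [hw1]
      refine tendsto_nhdsWithin_of_tendsto_nhds_of_eventually_within _ ?_ ?_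
      · exact ((continuous_fst.comp hcc).tendsto s).mono_left nhdsWithin_le_nhds
      · filter_upwards [self_mem_nhdsWithin] with y hy using he.symm_anti ψ hy
    have hlow : ∀ᶠ y in 𝓝[>] s, (c y).2 < h :=
      (((continuous_snd.comp hcc).tendsto s).mono_left nhdsWithin_le_nhds).eventually_lt_const hh1
    obtain ⟨y, hy1, hy2, hy3⟩ := ((ht.eventually ev).and (hlow.and self_mem_nhdsWithin)).exists
    have hyY : y ∈ Y := ⟨hs.1.trans (le_of_lt hy3), hull_mono_snd hy1 hy2.le⟩
    exact absurd (le_csSup hYb hyY) (not_le.2 hy3)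

/-- The vertical segment just below `w` lies in the hull and its image approaches `e w` from the
left by the twist, so it supports the new envelope there. -/
theorem noUpJump_image (he : IsTwistHomeo e) {A : Set (ℝ × ℝ)}
    (hA : e '' hull A ⊆ hull (e '' A)) : NoUpJump (e '' A) := by
  rintro _ ⟨w, hw, rfl⟩ h hh
  have hc : Continuous fun I : ℝ => e (w.1, I) := by fun_prop
  have hP : ∀ᶠ I in 𝓝[<] w.2, h < (e (w.1, I)).2 ∧ I < w.2 :=
    ((((continuous_snd.comp hc).tendsto w.2).mono_left nhdsWithin_le_nhds).eventually_const_lt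
      hh).and self_mem_nhdsWithin
  filter_upwards [eventually_nhdsLT_exists_eq (continuous_fst.comp hc) (he.mono w.1) hP]
    with x hx
  obtain ⟨I, -, rfl, hI, hIw⟩ := hx
  exact hull_mono_snd (hA ⟨(w.1, I), ⟨w, hw, rfl, hIw.le⟩, rfl⟩) hI.le

/-- The iterated images of the lower half plane. -/
def lowerImage (e : (ℝ × ℝ) ≃ₜ (ℝ × ℝ)) (n : ℕ) : Set (ℝ × ℝ) := e^[n] '' {z | z.2 ≤ 0}

theorem lowerImage_succ (n : ℕ) : lowerImage e (n + 1) = e '' lowerImage e n := by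
  simp only [lowerImage, Function.iterate_succ', image_comp]

theorem isClosed_lowerImage (n : ℕ) : IsClosed (lowerImage e n) := by
  induction n with
  | zero => simpa [lowerImage] using isClosed_le continuous_snd continuous_const
  | succ n ih => rw [lowerImage_succ]; exact e.isClosedMap _ ih

theorem exists_bound_lowerImage (he : IsTwistHomeo e) (n : ℕ) :
    ∃ M, ∀ z ∈ lowerImage e n, z.2 ≤ M := by
  obtain ⟨C, -, hC, -⟩ := he.exists_bound
  induction n with
  | zero => exact ⟨0, by simp [lowerImage]⟩
  | succ n ih =>
    obtain ⟨M, hM⟩ := ih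
    refine ⟨M + C, ?_⟩
    rw [lowerImage_succ]
    rintro _ ⟨w, hw, rfl⟩
    linarith [hM w hw, (abs_le.1 (hC w)).2]

theorem noUpJump_lowerImage (he : IsTwistHomeo e) (n : ℕ) : NoUpJump (lowerImage e n) := by
  induction n with
  | zero =>
    intro w hw h hh
    have hw' : w.2 ≤ 0 := by simpa [lowerImage] using hw
    refine Eventually.of_forall fun x => subset_hull _ ?_
    simpa [lowerImage] using hh.le.trans hw'
  | succ n ih =>
    obtain ⟨M, hM⟩ := he.exists_bound_lowerImage n
    rw [lowerImage_succ]
    exact he.noUpJump_image (he.image_hull_subset (isClosed_lowerImage n) hM ih)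

theorem image_hull_lowerImage_subset (he : IsTwistHomeo e) (n : ℕ) :
    e '' hull (lowerImage e n) ⊆ hull (lowerImage e (n + 1)) := by
  obtain ⟨M, hM⟩ := he.exists_bound_lowerImage n
  rw [lowerImage_succ]
  exact he.image_hull_subset (isClosed_lowerImage n) hM (he.noUpJump_lowerImage n)

theorem lowerImage_add_fst (he : IsTwistHomeo e) (n : ℕ) (m : ℤ) {z : ℝ × ℝ}
    (hz : z ∈ lowerImage e n) : z + ((m : ℝ), 0) ∈ lowerImage e n := by
  obtain ⟨w, hw, rfl⟩ := hz
  refine ⟨w + ((m : ℝ), 0), by simpa using hw, ?_⟩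
  simpa using he.iterate_add_int n w m 0

/-! ### Climbing orbits give returning orbits -/

/-- If orbits starting in the lower half plane climb arbitrarily high, then orbits that return to
their vertical modulo `1` climb arbitrarily high. -/
theorem exists_return_of_unbounded (he : IsTwistHomeo e)
    (h : ∀ L : ℝ, ∃ n, ∃ z ∈ lowerImage e n, L < z.2) (k : ℝ) (hk : 0 ≤ k) :
    ∃ N : ℕ, 0 < N ∧ ∃ P : ℝ × ℝ, P ∈ Icc (0 : ℝ) 1 ×ˢ Icc (0 : ℝ) 1 ∧
      ∃ s : ℤ, (e^[N] P).1 = P.1 + (s : ℝ) ∧ P.2 + k < (e^[N] P).2 := by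
  suffices H : ∃ N : ℕ, 0 < N ∧ ∃ P : ℝ × ℝ,
      ∃ s : ℤ, (e^[N] P).1 = P.1 + (s : ℝ) ∧ P.2 + k < (e^[N] P).2 by
    obtain ⟨N, hN, P, s, h1, h2⟩ := H
    -- Integer translation brings `P` into the unit square; a vertical shift is sheared once per
    -- iterate, whence the correction `N * ⌊P.2⌋` to `s`.
    have hP := he.iterate_add_int N P (-⌊P.1⌋) (-⌊P.2⌋)
    refine ⟨N, hN, P + (((-⌊P.1⌋ : ℤ) : ℝ), ((-⌊P.2⌋ : ℤ) : ℝ)), ?_, s - N * ⌊P.2⌋, ?_, ?_⟩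
    · have a1 := Int.floor_le P.1
      have a2 := Int.lt_floor_add_one P.1
      have b1 := Int.floor_le P.2
      have b2 := Int.lt_floor_add_one P.2
      simp only [mem_prod, mem_Icc, Prod.fst_add, Prod.snd_add]
      push_cast
      refine ⟨⟨?_, ?_⟩, ?_, ?_⟩ <;> linarith
    · rw [hP]; simp only [Prod.fst_add, h1]; push_cast; ring
    · rw [hP]; simp only [Prod.snd_add]; push_cast; linarith
  obtain ⟨C, hC0, hC, hD⟩ := he.exists_bound
  -- Height `h1` survives the loss of `C` in one extra iterate and still exceeds `k`; the further `2
  -- * C + 2` lets the shear beat an error `C` at each end and a prior displacement below 1, leaving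
  -- at least 1.
  set h1 := k + C + 1 with hh1
  obtain ⟨n, _, ⟨z, hz, rfl⟩, hL⟩ := h (h1 + 2 * C + 2)
  have hz' : z.2 ≤ 0 := hz
  set p : ℝ → ℝ × ℝ := fun I => e^[n] (z.1, I) with hp
  have hpc : Continuous p := (e.continuous.iterate n).comp (by fun_prop)
  have hpz : p z.2 = e^[n] z := rfl
  have hlow : ∀ n : ℕ, ∀ w : ℝ × ℝ, (e^[n] w).2 ≤ w.2 + n * C := by
    intro n
    induction n with
    | zero => intro w; simp
    | succ n ih =>
      intro w
      rw [Function.iterate_succ_apply]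
      have := ih (e w)
      have := (abs_le.1 (hC w)).2
      push_cast; linarith
  have hn : 0 < n := by
    rcases Nat.eq_zero_or_pos n with rfl | h
    · simp at hL; linarith
    · exact h
  -- `a` is the last parameter at which the image of the ray is no higher than `h1`.
  obtain ⟨a, haz, hpa, hab⟩ : ∃ a, a ≤ z.2 ∧ (p a).2 = h1 ∧ ∀ t ∈ Icc a z.2, h1 ≤ (p t).2 := by
    set Z : Set ℝ := {t | t ≤ z.2 ∧ (p t).2 ≤ h1}
    have hZc : IsClosed Z := isClosed_Iic.inter
      (isClosed_le (continuous_snd.comp hpc) continuous_const)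
    have hZb : BddAbove Z := ⟨z.2, fun t ht => ht.1⟩
    have hZn : Z.Nonempty := by
      refine ⟨min z.2 (h1 - n * C), min_le_left _ _, ?_⟩
      have := hlow n (z.1, min z.2 (h1 - n * C))
      have := min_le_right z.2 (h1 - n * C)
      simp only [hp] at *; linarith
    have hs : sSup Z ∈ Z := hZc.csSup_mem hZn hZb
    have hgt : ∀ t, sSup Z < t → t ≤ z.2 → h1 < (p t).2 := fun t ht htz => by
      by_contra hcon
      exact absurd (le_csSup hZb (show t ∈ Z from ⟨htz, not_lt.1 hcon⟩)) (not_le.2 ht)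
    have heq : (p (sSup Z)).2 = h1 := by
      refine le_antisymm hs.2 ?_
      have hlt : sSup Z < z.2 := by
        refine lt_of_le_of_ne hs.1 fun h => ?_
        have := hs.2
        rw [h, hpz] at this
        linarith
      refine ge_of_tendsto (((continuous_snd.comp hpc).tendsto (sSup Z)).mono_left
        (nhdsWithin_le_nhds (s := Ioi (sSup Z)))) ?_
      filter_upwards [Ioc_mem_nhdsGT hlt] with t ht using (hgt t ht.1 ht.2).le
    refine ⟨sSup Z, hs.1, heq, fun t ht => ?_⟩
    rcases ht.1.eq_or_lt with h | h
    · rw [← h, heq]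
    · exact (hgt t h ht.2).le
  by_cases hcase : 1 ≤ |(p z.2).1 - (p a).1|
  · obtain ⟨t, ht, s, hs⟩ := exists_eq_add_int (continuous_fst.comp hpc) haz hcase z.1
    refine ⟨n, hn, (z.1, t), s, hs, ?_⟩
    have := hab t ht
    have := ht.2
    simp only [hp] at *; linarith
  -- The arc is horizontally short but tall, so one more application of the twist stretches it over
  -- a unit.
  · have hcont : Continuous fun t => (e (p t)).1 := by fun_prop
    have hd : 1 ≤ |(e (p z.2)).1 - (e (p a)).1| := by
      refine le_trans ?_ (le_abs_self _)
      have h3 := abs_lt.1 (not_le.1 hcase)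
      have h4 := abs_le.1 (hD (p z.2))
      have h5 := abs_le.1 (hD (p a))
      rw [← hpz] at hL
      linarith [h3.1, h4.1, h5.2]
    obtain ⟨t, ht, s, hs⟩ := exists_eq_add_int hcont haz hd z.1
    have hit : e^[n + 1] (z.1, t) = e (p t) := Function.iterate_succ_apply' _ _ _
    refine ⟨n + 1, n.succ_pos, (z.1, t), s, by rw [hit]; exact hs, ?_⟩
    rw [hit]
    have := hab t ht
    have := ht.2
    have := (abs_le.1 (hC (p t))).1
    dsimp only
    linarith

end IsTwistHomeo

/-! ### The covering of the cylinder and its lower half -/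

theorem continuous_proj : Continuous proj :=
  (AddCircle.continuous_mk' (1 : ℝ) |>.comp continuous_fst).prodMk continuous_snd

theorem isOpenMap_proj : IsOpenMap proj :=
  (QuotientAddGroup.isOpenMap_coe (N := AddSubgroup.zmultiples (1 : ℝ))).prodMap IsOpenMap.id

theorem proj_surjective : Function.Surjective proj := by
  rintro ⟨x, y⟩
  obtain ⟨φ, rfl⟩ := QuotientAddGroup.mk_surjective x
  exact ⟨(φ, y), rfl⟩

theorem proj_add_int (z : ℝ × ℝ) (m : ℤ) : proj (z + ((m : ℝ), 0)) = proj z := by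
  refine Prod.ext ?_ (by simp [proj])
  simp [proj]

theorem exists_int_of_proj_eq {z w : ℝ × ℝ} (h : proj z = proj w) :
    ∃ m : ℤ, w = z + ((m : ℝ), 0) := by
  have h1 : (z.1 : UnitAddCircle) = w.1 := congrArg Prod.fst h
  have h2 : z.2 = w.2 := (Prod.ext_iff.1 h).2
  have h3 : ((w.1 - z.1 : ℝ) : UnitAddCircle) = 0 := by rw [AddCircle.coe_sub, h1, sub_self]
  obtain ⟨m, hm⟩ := (AddCircle.coe_eq_zero_iff (1 : ℝ)).1 h3
  refine ⟨m, Prod.ext ?_ (by simp [h2])⟩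
  simp only [zsmul_eq_mul, mul_one] at hm
  simp [hm]

/-- The lower half of the cylinder. -/
def lowerHalf : Set Cylinder := {p | p.2 < 0}

/-- The lower half of the cylinder is homeomorphic to the cylinder. -/
noncomputable def lowerHalfHomeomorph : lowerHalf ≃ₜ Cylinder where
  toFun p := (p.1.1, Real.log (-p.1.2))
  invFun q := ⟨(q.1, -Real.exp q.2), by simp [lowerHalf, Real.exp_pos]⟩
  left_inv := by
    rintro ⟨⟨x, y⟩, hy⟩
    have : 0 < -y := neg_pos.2 hy
    exact Subtype.ext (Prod.ext rfl (by simp only [Real.exp_log this, neg_neg]))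
  right_inv := by rintro ⟨x, y⟩; simp
  continuous_toFun := by
    refine (continuous_fst.comp continuous_subtype_val).prodMk ?_
    refine Continuous.log (by fun_prop) fun p => ?_
    have : p.1.2 < 0 := p.2
    linarith
  continuous_invFun := by fun_prop

theorem isOpen_lowerHalf : IsOpen lowerHalf := isOpen_lt continuous_snd continuous_const

theorem isCompact_slab (a b : ℝ) : IsCompact {p : Cylinder | p.2 ∈ Icc a b} := by
  have : {p : Cylinder | p.2 ∈ Icc a b} = univ ×ˢ Icc a b := by ext; simp
  rw [this]
  exact isCompact_univ.prod isCompact_Icc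

theorem isCompact_frontier_lowerHalf : IsCompact (frontier lowerHalf) := by
  refine (isCompact_slab 0 0).of_isClosed_subset isClosed_frontier fun p hp => ?_
  have h : p.2 = 0 := frontier_lt_subset_eq continuous_snd continuous_const hp
  simp [h]

/-! ### Zero flux and invariant measure -/

section Flux

variable {F : Cylinder → Cylinder} {μ : Measure Cylinder}

theorem IsExact.measure_image (hμ : IsExact μ F) (hF : Function.Injective F) {X : Set Cylinder}
    (hX : MeasurableSet (F '' X)) : μ (F '' X) = μ X := by
  rw [← hμ.invariant.measure_preimage hX.nullMeasurableSet, preimage_image_eq _ hF]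

/-- An exact map cannot map an open region that contains the lower half cylinder and is bounded
above into itself, unless it maps it onto itself up to a null set. -/
theorem IsExact.measure_diff_image_eq_zero (hμ : IsExact μ F) (hF : Function.Injective F)
    (hFo : IsOpenMap F) {U : Set Cylinder} (hU : IsOpen U) (hlow : lowerHalf ⊆ U) {L : ℝ}
    (hL : ∀ p ∈ U, p.2 ≤ L) (hFU : F '' U ⊆ U) {K : ℝ}
    (hK : {p : Cylinder | p.2 < K} ⊆ F '' lowerHalf) (hK0 : K ≤ 0) : μ (U \ F '' U) = 0 := by
  set B := lowerHalf
  set E : Set Cylinder := {p | p.2 < K}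
  have hEm : MeasurableSet E := (isOpen_lt continuous_snd continuous_const).measurableSet
  have hBm : MeasurableSet B := isOpen_lowerHalf.measurableSet
  have hFBm : MeasurableSet (F '' B) := (hFo _ isOpen_lowerHalf).measurableSet
  have hFUm : MeasurableSet (F '' U) := (hFo _ hU).measurableSet
  have hEB : E ⊆ B := fun p (hp : p.2 < K) => show p.2 < 0 from hp.trans_le hK0
  have hflux : μ (F '' B \ B) = μ (B \ F '' B) :=
    hμ.flux B isOpen_lowerHalf ⟨lowerHalfHomeomorph⟩ isCompact_frontier_lowerHalf
  -- The lower end `E` is removed because the measures of `B` and `U` may be infinite. Flux is used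
  -- only for `B`; the part of `U` above `B` is handled by invariance of `μ`.
  have hBE : μ (F '' B \ E) = μ (B \ E) := by
    rw [← measure_inter_add_sdiff (F '' B \ E) hBm, ← measure_inter_add_sdiff (B \ E) hFBm]
    congr 1
    · congr 1; ext p; simp only [mem_inter_iff, Set.mem_sdiff]; tauto
    · have h1 : (F '' B \ E) \ B = F '' B \ B := by
        ext p; simp only [Set.mem_sdiff]
        exact ⟨fun h => ⟨h.1.1, h.2⟩, fun h => ⟨⟨h.1, fun hE => h.2 (hEB hE)⟩, h.2⟩⟩
      have h2 : (B \ E) \ F '' B = B \ F '' B := by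
        ext p; simp only [Set.mem_sdiff]
        exact ⟨fun h => ⟨h.1.1, h.2⟩, fun h => ⟨⟨h.1, fun hE => h.2 (hK hE)⟩, h.2⟩⟩
      rw [h1, h2, hflux]
  have hUB : μ (F '' U \ F '' B) = μ (U \ B) := by
    rw [← image_sdiff hF]
    exact hμ.measure_image hF (by rw [image_sdiff hF]; exact hFUm.diff hFBm)
  have hUE : μ (F '' U \ E) = μ (U \ E) := by
    rw [← measure_inter_add_sdiff (F '' U \ E) hFBm, ← measure_inter_add_sdiff (U \ E) hBm]
    have h1 : (F '' U \ E) ∩ F '' B = F '' B \ E := by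
      ext p; simp only [mem_inter_iff, Set.mem_sdiff]
      exact ⟨fun h => ⟨h.2, h.1.2⟩, fun h => ⟨⟨image_mono hlow h.1, h.2⟩, h.1⟩⟩
    have h2 : (F '' U \ E) \ F '' B = F '' U \ F '' B := by
      ext p; simp only [Set.mem_sdiff]
      exact ⟨fun h => ⟨h.1.1, h.2⟩, fun h => ⟨⟨h.1, fun hE => h.2 (hK hE)⟩, h.2⟩⟩
    have h3 : (U \ E) ∩ B = B \ E := by
      ext p; simp only [mem_inter_iff, Set.mem_sdiff]
      exact ⟨fun h => ⟨h.2, h.1.2⟩, fun h => ⟨⟨hlow h.1, h.2⟩, h.1⟩⟩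
    have h4 : (U \ E) \ B = U \ B := by
      ext p; simp only [Set.mem_sdiff]
      exact ⟨fun h => ⟨h.1.1, h.2⟩, fun h => ⟨⟨h.1, fun hE => h.2 (hEB hE)⟩, h.2⟩⟩
    rw [h1, h2, h3, h4, hBE, hUB]
  have hfin : μ (U \ E) < ⊤ := (measure_mono fun p hp =>
    show p ∈ {p : Cylinder | p.2 ∈ Icc K L} from ⟨not_lt.1 hp.2, hL p hp.1⟩).trans_lt
    (hμ.finite_compact _ (isCompact_slab K L))
  have hdiff : U \ F '' U = (U \ E) \ (F '' U \ E) := by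
    ext p; simp only [Set.mem_sdiff]
    exact ⟨fun h => ⟨⟨h.1, fun hE => h.2 (image_mono hlow (hK hE))⟩, fun h' => h.2 h'.1⟩,
      fun h => ⟨h.1.1, fun h' => h.2 ⟨h', h.1.2⟩⟩⟩
  rw [hdiff, measure_sdiff (sdiff_subset_sdiff_left hFU) (hFUm.diff hEm).nullMeasurableSet
    (by rw [hUE]; exact hfin.ne), hUE, tsub_self]

end Flux

/-! ### Graphs are essential curves -/

/-- The identity of the circle is not homotopic to a constant. -/
theorem not_nullhomotopic_id_circle : ¬ (ContinuousMap.id UnitAddCircle).Nullhomotopic := by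
  rintro ⟨c, ⟨H⟩⟩
  have cov : IsCoveringMap ((↑) : ℝ → UnitAddCircle) := AddCircle.isCoveringMap_coe (1 : ℝ)
  obtain ⟨c', rfl⟩ := QuotientAddGroup.mk_surjective c
  have H0 : ∀ a, H.symm.toContinuousMap (0, a) = ((ContinuousMap.const UnitAddCircle c' a : ℝ) :
      UnitAddCircle) := fun a => H.symm.apply_zero a
  set Γ := cov.liftHomotopy H.symm.toContinuousMap (ContinuousMap.const _ c') H0
  -- The end of the lifted homotopy is a continuous section of ℝ → ℝ/ℤ. Uniqueness of lifts makes it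
  -- a translation on ℝ, contradicting its period 1.
  set f : UnitAddCircle → ℝ := fun a => Γ (1, a)
  have hfc : Continuous f := by fun_prop
  have hf : ∀ a, ((f a : ℝ) : UnitAddCircle) = a := fun a =>
    (congrFun (cov.liftHomotopy_lifts H.symm.toContinuousMap (ContinuousMap.const _ c') H0)
      (1, a)).trans (H.symm.apply_one a)
  have hlift : (fun x : ℝ => f x) = fun x => x + f 0 := by
    refine cov.eq_of_comp_eq (hfc.comp (AddCircle.continuous_mk' (1 : ℝ))) (by fun_prop) ?_ 0
      (by simp)
    ext x
    simp [hf]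
  have h1 := congrFun hlift 1
  have h2 : ((1 : ℝ) : UnitAddCircle) = 0 := AddCircle.coe_period (1 : ℝ)
  simp only [h2] at h1
  linarith

/-- The graph of a continuous function on the circle is an essential simple closed curve. -/
theorem isRIC_graph {F : Cylinder → Cylinder} {g : UnitAddCircle → ℝ} (hg : Continuous g)
    (hF : F '' range (fun x => (x, g x)) = range fun x => (x, g x)) :
    IsRIC F (range fun x => (x, g x)) := by
  refine ⟨⟨⟨fun x => (x, g x), by fun_prop⟩, fun x y h => congrArg Prod.fst h, fun h => ?_, rfl⟩, hF⟩
  exact not_nullhomotopic_id_circle (h.comp_right ⟨Prod.fst, continuous_fst⟩)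

/-! ### Birkhoff's graph argument -/

/-- Birkhoff's theorem for regions below an envelope: an open, vertically downward closed set that
is bounded above and invariant under a twist homeomorphism lies below the graph of a continuous
function. -/
theorem IsTwistHomeo.exists_continuous_eq_below {e : (ℝ × ℝ) ≃ₜ (ℝ × ℝ)} (he : IsTwistHomeo e)
    {U : Set (ℝ × ℝ)} (hU : IsOpen U) (hdown : ∀ x i j, i ≤ j → (x, j) ∈ U → (x, i) ∈ U)
    (hlow : ∀ z : ℝ × ℝ, z.2 < 0 → z ∈ U) {L : ℝ} (hL : ∀ z ∈ U, z.2 ≤ L)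
    (heU : ∀ z, e z ∈ U ↔ z ∈ U) :
    ∃ G : ℝ → ℝ, Continuous G ∧ ∀ z, z ∈ U ↔ z.2 < G z.1 := by
  set G : ℝ → ℝ := fun x => sSup {i | (x, i) ∈ U}
  have hb : ∀ x, BddAbove {i | (x, i) ∈ U} := fun x => ⟨L, fun i hi => hL _ hi⟩
  have hne : ∀ x, {i | (x, i) ∈ U}.Nonempty := fun x => ⟨-1, hlow _ (by norm_num)⟩
  have hmem : ∀ x i, (x, i) ∈ U ↔ i < G x := by
    intro x i
    constructor
    · intro hi
      have ho : IsOpen {i | (x, i) ∈ U} := hU.preimage (by fun_prop)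
      obtain ⟨j, hj, hij⟩ := (mem_nhdsGT_iff_exists_Ioo_subset.1
        (nhdsWithin_le_nhds (ho.mem_nhds hi)))
      obtain ⟨t, ht⟩ := exists_between (show i < j from hj)
      exact ht.1.trans_le (le_csSup (hb x) (hij ht))
    · intro hi
      obtain ⟨j, hj, hij⟩ := exists_lt_of_lt_csSup (hne x) hi
      exact hdown x i j hij.le hj
  refine ⟨G, ?_, fun z => hmem z.1 z.2⟩
  rw [continuous_iff_continuousAt]
  intro x₀
  refine tendsto_order.2 ⟨fun a ha => ?_, fun b hbG => ?_⟩
  -- Lower semicontinuity is openness of `U`; only upper semicontinuity needs the twist.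
  · have ho : IsOpen {x | (x, a) ∈ U} := hU.preimage (by fun_prop)
    filter_upwards [ho.mem_nhds ((hmem x₀ a).2 ha)] with x hx using (hmem x a).1 hx
  · have hs : (x₀, G x₀) ∉ U := fun h => lt_irrefl _ ((hmem _ _).1 h)
    rw [← nhdsNE_sup_pure, ← nhdsLT_sup_nhdsGT, eventually_sup, eventually_sup]
    refine ⟨⟨?_, ?_⟩, hbG⟩
    -- Left side: the vertical above `w` avoids `U`, and so does its preimage, which leaves `(x₀, G
    -- x₀)` to the left and caps `G`.
    · set w := e (x₀, G x₀) with hw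
      have hwU : w ∉ U := fun h => hs ((heU _).1 h)
      set c : ℝ → ℝ × ℝ := fun y => e.symm (w.1, y)
      have hcc : Continuous c := by fun_prop
      have hc0 : c w.2 = (x₀, G x₀) := e.symm_apply_apply _
      have hP : ∀ᶠ y in 𝓝[>] w.2, (c y).2 < b :=
        (((continuous_snd.comp hcc).tendsto w.2).mono_left nhdsWithin_le_nhds).eventually_lt_const
          (by simpa [hc0] using hbG)
      have hev := eventually_nhdsLT_exists_eq_of_anti (continuous_fst.comp hcc)
        (he.symm_anti w.1) hP
      simp only [Function.comp_apply, hc0] at hev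
      filter_upwards [hev] with x hx
      obtain ⟨y, hy, rfl, hyb⟩ := hx
      refine lt_of_le_of_lt (not_lt.1 fun hlt => hwU ?_) hyb
      have h1 : c y ∈ U := (hmem (c y).1 (c y).2).2 hlt
      have h2 := (heU _).2 h1
      rw [show e (c y) = (w.1, y) from e.apply_symm_apply _] at h2
      exact hdown w.1 w.2 y hy.le h2
    -- Right side: the same with `e` and its inverse exchanged, since images of verticals go right.
    · set w := e.symm (x₀, G x₀) with hw
      have hc0 : e (w.1, w.2) = (x₀, G x₀) := e.apply_symm_apply _
      have hwU : w ∉ U := fun h => hs (by rw [← hc0]; exact (heU _).2 h)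
      set c : ℝ → ℝ × ℝ := fun y => e (w.1, y)
      have hcc : Continuous c := by fun_prop
      have hP : ∀ᶠ y in 𝓝[>] w.2, (c y).2 < b :=
        (((continuous_snd.comp hcc).tendsto w.2).mono_left nhdsWithin_le_nhds).eventually_lt_const
          (by simpa [c, hc0] using hbG)
      have hev := eventually_nhdsGT_exists_eq (continuous_fst.comp hcc) (he.mono w.1) hP
      simp only [Function.comp_apply, c, hc0] at hev
      filter_upwards [hev] with x hx
      obtain ⟨y, hy, rfl, hyb⟩ := hx
      refine lt_of_le_of_lt (not_lt.1 fun hlt => hwU ?_) hyb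
      have h1 : c y ∈ U := (hmem (c y).1 (c y).2).2 hlt
      exact hdown w.1 w.2 y hy.le ((heU _).1 h1)

/-! ### The invariant circle in the bounded case -/

theorem add_mem_closure_of_forall {X : Set (ℝ × ℝ)} {v : ℝ × ℝ} (h : ∀ z ∈ X, z + v ∈ X) :
    ∀ z ∈ closure X, z + v ∈ closure X :=
  fun _ hz => map_mem_closure (f := fun z => z + v) (by fun_prop) hz h

theorem add_mem_interior_of_forall {X : Set (ℝ × ℝ)} {v : ℝ × ℝ} (h : ∀ z ∈ X, z + v ∈ X) :
    ∀ z ∈ interior X, z + v ∈ interior X := by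
  intro z hz
  have ho : IsOpen ((Homeomorph.addRight v) '' interior X) :=
    (Homeomorph.addRight v).isOpenMap _ isOpen_interior
  refine interior_maximal ?_ ho ⟨z, hz, rfl⟩
  rintro _ ⟨w, hw, rfl⟩
  exact h w (interior_subset hw)

/-- If the orbits starting in the lower half plane stay below some height, there is a rotational
invariant circle. -/
theorem exists_isRIC_of_bounded {e : (ℝ × ℝ) ≃ₜ (ℝ × ℝ)} (he : IsTwistHomeo e)
    {F : Cylinder → Cylinder} (hF : IsLift e F) {μ : Measure Cylinder} (hμ : IsExact μ F) {L : ℝ}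
    (hL : ∀ n, ∀ z ∈ IsTwistHomeo.lowerImage e n, z.2 ≤ L) : ∃ C, IsRIC F C := by
  obtain ⟨C, hC0, hC, -⟩ := he.exists_bound
  have hFinj : Function.Injective F := by
    intro p q hpq
    obtain ⟨z, rfl⟩ := proj_surjective p
    obtain ⟨w, rfl⟩ := proj_surjective q
    rw [hF, hF] at hpq
    obtain ⟨m, hm⟩ := exists_int_of_proj_eq hpq
    have h := he.apply_add_int z m 0
    simp only [Int.cast_zero, add_zero] at h
    rw [← h] at hm
    rw [e.injective hm, proj_add_int]
  have himage : ∀ X : Set (ℝ × ℝ), F '' (proj '' X) = proj '' (e '' X) := fun X => by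
    simp only [image_image, hF _]
  have hFo : IsOpenMap F := fun X hX => by
    rw [← image_preimage_eq X proj_surjective, himage]
    exact isOpenMap_proj _ (e.isOpenMap _ (hX.preimage continuous_proj))
  set R : Set (ℝ × ℝ) := ⋃ n, hull (IsTwistHomeo.lowerImage e n)
  have hRdown : ∀ t : ℝ, 0 ≤ t → ∀ z ∈ R, z + (0, -t) ∈ R := by
    intro t ht z hz
    obtain ⟨n, w, hw, h1, h2⟩ := mem_iUnion.1 hz
    exact mem_iUnion.2 ⟨n, w, hw, by simpa using h1, by simp; linarith⟩
  have hRper : ∀ m : ℤ, ∀ z ∈ R, z + ((m : ℝ), 0) ∈ R := by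
    intro m z hz
    obtain ⟨n, w, hw, h1, h2⟩ := mem_iUnion.1 hz
    exact mem_iUnion.2 ⟨n, _, he.lowerImage_add_fst n m hw, by simpa using h1, by simpa using h2⟩
  have hRL : ∀ z ∈ R, z.2 ≤ L := by
    intro z hz
    obtain ⟨n, w, hw, h1, h2⟩ := mem_iUnion.1 hz
    exact h2.trans (hL n w hw)
  have heR : e '' R ⊆ R := by
    rw [image_iUnion]
    exact iUnion_subset fun n => (he.image_hull_lowerImage_subset n).trans
      (subset_iUnion (fun n => hull (IsTwistHomeo.lowerImage e n)) (n + 1))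
  set U₀ := interior R
  have hU₀ : IsOpen U₀ := isOpen_interior
  have hlow₀ : {z : ℝ × ℝ | z.2 < 0} ⊆ U₀ := by
    refine interior_maximal (fun z hz => mem_iUnion.2 ⟨0, subset_hull _ ?_⟩)
      (isOpen_lt continuous_snd continuous_const)
    simpa [IsTwistHomeo.lowerImage] using le_of_lt hz
  have heU₀ : e '' U₀ ⊆ U₀ := by
    rw [e.image_interior]; exact interior_mono heR
  have hper₀ : ∀ m : ℤ, ∀ z ∈ U₀, z + ((m : ℝ), 0) ∈ U₀ := fun m =>
    add_mem_interior_of_forall (hRper m)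
  -- The part of `U₀` outside the closure of its image is open and projects into a null set, hence
  -- is empty since `μ` charges open sets.
  have hdense : U₀ ⊆ closure (e '' U₀) := by
    have hnull : μ (proj '' U₀ \ F '' (proj '' U₀)) = 0 := by
      refine hμ.measure_diff_image_eq_zero hFinj hFo (isOpenMap_proj _ hU₀) ?_ (L := L) ?_ ?_
        (K := -C) ?_ (by linarith)
      · intro p hp
        obtain ⟨z, rfl⟩ := proj_surjective p
        exact ⟨z, hlow₀ hp, rfl⟩
      · rintro _ ⟨z, hz, rfl⟩
        exact hRL z (interior_subset hz)
      · rw [himage]; exact image_mono heU₀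
      · intro p hp
        obtain ⟨z, rfl⟩ := proj_surjective p
        refine ⟨proj (e.symm z), ?_, by rw [hF, e.apply_symm_apply]⟩
        have h1 := (abs_le.1 (hC (e.symm z))).1
        rw [e.apply_symm_apply] at h1
        have h2 : z.2 < -C := hp
        show (e.symm z).2 < 0
        linarith
    by_contra hcon
    obtain ⟨z, hz, hzc⟩ := not_subset.1 hcon
    have hO : IsOpen (U₀ \ closure (e '' U₀)) := hU₀.sdiff isClosed_closure
    have hpos := hμ.pos_open _ (isOpenMap_proj _ hO) ⟨proj z, z, ⟨hz, hzc⟩, rfl⟩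
    refine (hpos.trans_le (measure_mono ?_)).ne' hnull
    rintro _ ⟨w, ⟨hw, hwc⟩, rfl⟩
    refine ⟨⟨w, hw, rfl⟩, fun hmem => hwc (subset_closure ?_)⟩
    rw [himage] at hmem
    obtain ⟨_, ⟨u, hu, rfl⟩, huw⟩ := hmem
    obtain ⟨m, rfl⟩ := exists_int_of_proj_eq huw
    refine ⟨u + ((m : ℝ), 0), hper₀ m u hu, ?_⟩
    simpa using he.apply_add_int u m 0
  have hcl : e '' closure U₀ = closure U₀ := by
    rw [e.image_closure]
    exact (closure_mono heU₀).antisymm (closure_minimal hdense isClosed_closure)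
  -- This regularization turns density of the image into exact invariance, keeping periodicity, the
  -- bound and downward closedness.
  set U := interior (closure U₀)
  have hU : IsOpen U := isOpen_interior
  have hU₀U : U₀ ⊆ U := interior_maximal subset_closure hU₀
  have heU' : e '' U = U := by rw [e.image_interior, hcl]
  have heU : ∀ z, e z ∈ U ↔ z ∈ U := fun z => by
    conv_lhs => rw [← heU']
    exact e.injective.mem_set_image
  have hdown : ∀ x i j, i ≤ j → (x, j) ∈ U → (x, i) ∈ U := by
    intro x i j hij h
    have := add_mem_interior_of_forall (add_mem_closure_of_forall
      (add_mem_interior_of_forall (hRdown (j - i) (sub_nonneg.2 hij)))) _ h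
    simpa using this
  have hper : ∀ m : ℤ, ∀ z ∈ U, z + ((m : ℝ), 0) ∈ U := fun m =>
    add_mem_interior_of_forall (add_mem_closure_of_forall (hper₀ m))
  have hUL : ∀ z ∈ U, z.2 ≤ L := fun z hz =>
    closure_minimal (fun w hw => hRL w (interior_subset hw))
      (isClosed_le continuous_snd continuous_const) (interior_subset hz)
  obtain ⟨G, hGc, hG⟩ := he.exists_continuous_eq_below hU hdown
    (fun z hz => hU₀U (hlow₀ hz)) hUL heU
  have hGper : Function.Periodic G 1 := by
    intro x
    have h1 : ∀ x, ∀ m : ℤ, G x ≤ G (x + m) := fun x m => by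
      refine le_of_forall_lt fun i hi => ?_
      have := (hG _).1 (hper m (x, i) ((hG _).2 hi))
      simpa using this
    refine le_antisymm ?_ (by simpa using h1 x 1)
    simpa using h1 (x + 1) (-1)
  have hfront : ∀ z, z ∈ closure U ↔ z.2 ≤ G z.1 := by
    intro z
    constructor
    · intro hz
      exact closure_minimal (fun w hw => ((hG w).1 hw).le)
        (isClosed_le continuous_snd (hGc.comp continuous_fst)) hz
    · intro hz
      have ht : Tendsto (fun t : ℝ => (z.1, t)) (𝓝[<] z.2) (𝓝 z) :=
        ((by fun_prop : Continuous fun t : ℝ => (z.1, t)).tendsto z.2).mono_left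
          nhdsWithin_le_nhds
      refine mem_closure_of_tendsto ht ?_
      filter_upwards [self_mem_nhdsWithin] with t ht
      exact (hG _).2 (lt_of_lt_of_le ht hz)
  have hecl : ∀ z, e z ∈ closure U ↔ z ∈ closure U := fun z => by
    conv_lhs => rw [← heU', ← e.image_closure]
    exact e.injective.mem_set_image
  -- The graph is the closure of `U` minus `U`, a difference of two invariant sets.
  have hgraph : ∀ z, (e z).2 = G (e z).1 ↔ z.2 = G z.1 := fun z => by
    have h1 := hecl z
    have h2 := heU z
    rw [hfront, hfront] at h1
    rw [hG, hG] at h2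
    rw [eq_iff_le_not_lt, eq_iff_le_not_lt, h1, h2]
  set g : UnitAddCircle → ℝ := hGper.lift
  have hgG : ∀ x : ℝ, g x = G x := fun x => hGper.lift_coe x
  have hgc : Continuous g := continuous_coinduced_dom.2 hGc
  refine ⟨_, isRIC_graph hgc ?_⟩
  have hrange : range (fun x => (x, g x)) = proj '' {z | z.2 = G z.1} := by
    ext p
    constructor
    · rintro ⟨x, rfl⟩
      obtain ⟨φ, rfl⟩ := QuotientAddGroup.mk_surjective x
      exact ⟨(φ, G φ), rfl, Prod.ext rfl (hgG φ).symm⟩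
    · rintro ⟨z, hz, rfl⟩
      exact ⟨z.1, Prod.ext rfl ((hgG z.1).trans (Eq.symm hz))⟩
  rw [hrange, himage]
  congr 1
  ext z
  constructor
  · rintro ⟨w, hw, rfl⟩
    exact (hgraph w).2 hw
  · intro hz
    refine ⟨e.symm z, (hgraph _).1 ?_, e.apply_symm_apply z⟩
    rw [e.apply_symm_apply]; exact hz

/-- A lift of a torus twist map is a twist homeomorphism of the plane. -/
theorem exists_isTwistHomeo_of_mem_TQ {T : ℝ × ℝ → ℝ × ℝ} (hT : T ∈ TQ) :
    ∃ e : (ℝ × ℝ) ≃ₜ (ℝ × ℝ), (e : ℝ × ℝ → ℝ × ℝ) = T ∧ IsTwistHomeo e := by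
  obtain ⟨⟨⟨hTc, S, hSc, hl, hr⟩, -, -, htw, -, -, -⟩, h1, h2, h3, h4⟩ := hT
  refine ⟨⟨⟨T, S, hl, hr⟩, hTc.continuous, hSc.continuous⟩, rfl, ?_, ?_, ?_⟩
  · exact fun φ => strictMono_of_deriv_pos (htw φ)
  · rintro ⟨x, y⟩
    exact Prod.ext (by simpa using h3 x y) (by simpa using h1 x y)
  · rintro ⟨x, y⟩
    exact Prod.ext (by simpa using h4 x y) (by simpa using h2 x y)

end TwistMap

theorem mainTheorem7 (T : ℝ × ℝ → ℝ × ℝ) (hT : T ∈ TwistMap.TQ)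
    (That : TwistMap.Cylinder → TwistMap.Cylinder) (hThat : TwistMap.IsLift T That)
    (μ : MeasureTheory.Measure TwistMap.Cylinder) (hμ : TwistMap.IsExact μ That)
    (hRIC : ¬ ∃ C : Set TwistMap.Cylinder, TwistMap.IsRIC That C)
    (k : ℕ) (hk : 0 < k) :
    ∃ N : ℕ, 0 < N ∧ ∃ P : ℝ × ℝ, P ∈ Set.Icc (0 : ℝ) 1 ×ˢ Set.Icc (0 : ℝ) 1 ∧
      ∃ s : ℤ, (T^[N] P).1 = P.1 + (s : ℝ) ∧ P.2 + (k : ℝ) < (T^[N] P).2 := by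
  obtain ⟨e, rfl, he⟩ := TwistMap.exists_isTwistHomeo_of_mem_TQ hT
  refine he.exists_return_of_unbounded (fun L => ?_) k k.cast_nonneg
  by_contra! hL
  exact hRIC (TwistMap.exists_isRIC_of_bounded he hThat hμ hL)
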